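/- Let $n\ge 2$ and let $L_1\ge L_2\ge\dots\ge L_n>0$. Call $U\subseteq\mathbb{R}^n_{\ge 0}$ a utility set with maximum achievable utilities $L=(L_1,\dots,L_n)$ if $U$ is compact, convex, monotone (if $u\in U$ and $0\le v\le u$ coordinatewise, then $v\in U$), and $\max_{u\in U}u_i=L_i$ for every $i$. For such $U$, let $u^*$ be a utilitarian solution, i.e. a maximizer of $\sum_i u_i$ over $U$, and let $u^{PF}$ be the proportionally fair solution, i.e. the vector $u^{PF}\in U$ with positive entries such that $\sum_{i=1}^n (u_i-u_i^{PF})/u_i^{PF}\le 0$ for all $u\in U$. The price of proportional fairness $POF(U;PF)=\big(\sum_i u_i^*-\sum_i u_i^{PF}\big)/\sum_i u_i^*$ is then well defined (it exists and does not depend on the choice of solutions). Put $$m(L)=\min_{1\le l\le n}\frac{\big(\sum_{i=1}^l\sqrt{L_i}\big)^2+\sum_{i=l+1}^nL_i}{n\sum_{i=1}^lL_i},\qquad t(L)=\frac{\Big(\sqrt{L_2^2+2L_1L_2+(L_1+L_2)\sum_{i=3}^nL_i}+\sqrt{L_1L_2}\Big)^2}{n(L_1+L_2)^2}.$$ (1)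 If $L_2\sum_{i=1}^nL_i\le L_1^2$, then $POF(U;PF)\le 1-m(L)$ for every utility set $U$ with maximum achievable utilities $L$. (2) If $L_2\sum_{i=1}^nL_i> L_1^2$, then $POF(U;PF)\le 1-\min\{m(L),t(L)\}$ for every utility set $U$ with maximum achievable utilities $L$. Moreover, for every such $L$ the bound that applies is tight: there is a utility set $U$ with maximum achievable utilities $L$ for which equality holds. -/

import Mathlib

/-- `U` is a utility set of `n` players with maximum achievable utilities `L`: a compact, convex
and monotone set of nonnegative utility vectors such that `max {u i | u ∈ U} = L i` for every
player `i`. -/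
structure IsUtilitySet {n : ℕ} (L : Fin n → ℝ) (U : Set (Fin n → ℝ)) : Prop where
  isCompact : IsCompact U
  convex : Convex ℝ U
  nonneg : ∀ u ∈ U, 0 ≤ u
  monotone : ∀ u ∈ U, ∀ v : Fin n → ℝ, 0 ≤ v → v ≤ u → v ∈ U
  isGreatest : ∀ i, IsGreatest ((fun u : Fin n → ℝ => u i) '' U) (L i)

/-- `u` is a utilitarian solution: it maximizes the sum of the utilities over `U`. -/
def IsUtilitarian {n : ℕ} (U : Set (Fin n → ℝ)) (u : Fin n → ℝ) : Prop :=
  u ∈ U ∧ ∀ v ∈ U, ∑ i, v i ≤ ∑ i, u i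

/-- `u` is a proportionally fair solution: a feasible vector with positive entries such that for
every feasible `v` the aggregate of the proportional changes is zero or negative. -/
def IsPropFair {n : ℕ} (U : Set (Fin n → ℝ)) (u : Fin n → ℝ) : Prop :=
  u ∈ U ∧ (∀ i, 0 < u i) ∧ ∀ v ∈ U, ∑ i, (v i - u i) / u i ≤ 0

/-- `p` is the price of proportional fairness of `U`: the relative loss of total utility when a
proportionally fair solution replaces a utilitarian solution. -/
def IsPriceOfPropFairness {n : ℕ} (U : Set (Fin n → ℝ)) (p : ℝ) : Prop :=
  ∃ uStar uPF : Fin n → ℝ, IsUtilitarian U uStar ∧ IsPropFair U uPF ∧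
    p = (∑ i, uStar i - ∑ i, uPF i) / ∑ i, uStar i

/-- `((∑_{i ≤ l} √L_i)² + ∑_{i > l} L_i) / (n ∑_{i ≤ l} L_i)`. The players are indexed from `0`
in `Fin n`, so that the first `l` players are those with `i.val < l`. -/
noncomputable def prefixRatio {n : ℕ} (L : Fin n → ℝ) (l : ℕ) : ℝ :=
  ((∑ i : Fin n with i.val < l, √(L i)) ^ 2 + ∑ i : Fin n with l ≤ i.val, L i) /
    (n * ∑ i : Fin n with i.val < l, L i)

/-- The minimum of `prefixRatio L l` over `l = 1, …, n`. -/
noncomputable def minPrefixRatio {n : ℕ} (hn : 2 ≤ n) (L : Fin n → ℝ) : ℝ :=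
  (Finset.Icc 1 n).inf' (Finset.nonempty_Icc.mpr (by omega)) (prefixRatio L)

/-- `(√(L₂² + 2 L₁ L₂ + (L₁ + L₂) ∑_{i ≥ 3} L_i) + √(L₁ L₂))² / (n (L₁ + L₂)²)`, where
`L₁`, `L₂` are the entries of `L` with indices `0`, `1`. -/
noncomputable def pairRatio {n : ℕ} (hn : 2 ≤ n) (L : Fin n → ℝ) : ℝ :=
  let L₁ := L ⟨0, by omega⟩
  let L₂ := L ⟨1, by omega⟩
  (√(L₂ ^ 2 + 2 * L₁ * L₂ + (L₁ + L₂) * ∑ i : Fin n with 2 ≤ i.val, L i) + √(L₁ * L₂)) ^ 2 /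
    (n * (L₁ + L₂) ^ 2)

/-! Write `x i = √(L i)`. With `a` the fair vector and `v` a competitor, put `b i = n * a i / L i`
and `z i = v i / (n * a i)`. Fairness tested on the single-player vectors gives `b ≥ 1`, and tested
on `v` it gives `∑ z ≤ 1`; also `z i * b i = v i / L i ≤ 1`. Bounding the price thus means finding
the best `ρ` with `ρ * ∑ L z b ≤ ∑ L b`, which is `KnapsackBound`. For fixed `z` the problem is
linear in each `b i`, so `b i` may be taken as `1 / z i` on `S = {ρ z i > 1}` and `1` elsewhere. A
multiplier `μ²` for `∑ z ≤ 1` then bounds the difference below by `2Aμ - μ² + T - (1 + ρ)C`, where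
`A`, `C` are the sums of `x`, `x²` over `S` and `T = ∑ x²`; this needs `√ρ * x i ≤ μ` off `S`. The
choice `μ = A` gives the subset inequality `A² + T - (1 + ρ)C ≥ 0`, whose worst sets are prefixes
(`exists_prefix_le`): this is `m(L)`. If `A` is too small, `μ = √ρ * x j` for the largest `j`
outside `S`; `tangent_estimate` reduces this to subset inequalities and to the case of a single
filled player. That case is governed by the two largest players (`pair_estimate`), and its equality
case is `t(L)`. For tightness, equality in either inequality prescribes `b` and `v`, and a box cut
by one hyperplane realizes them (`KnapsackBound.exists_price_eq`). -/

open Finset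

/-! ### Inequalities behind the fractional knapsack bound -/

/-- Among all sets of indices, a prefix minimizes `(∑ x)² - (1 + ρ) ∑ x²` for antitone `x`. -/
theorem exists_prefix_le {n : ℕ} {x : Fin n → ℝ} (hx : ∀ i, 0 < x i) (hanti : Antitone x)
    {ρ : ℝ} (hρ : 0 ≤ ρ) (S : Finset (Fin n)) :
    ∃ l ≤ n, (∑ i : Fin n with i.val < l, x i) ^ 2 -
        (1 + ρ) * ∑ i : Fin n with i.val < l, x i ^ 2 ≤
      (∑ i ∈ S, x i) ^ 2 - (1 + ρ) * ∑ i ∈ S, x i ^ 2 := by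
  classical
  set P : Finset (Fin n) → ℝ := fun S => (∑ i ∈ S, x i) ^ 2 - (1 + ρ) * ∑ i ∈ S, x i ^ 2 with hP
  obtain ⟨M, -, hM⟩ := Finset.exists_min_image (univ : Finset (Finset (Fin n))) P ⟨S, mem_univ _⟩
  -- Ties among minimizers are broken by the least sum of indices, so that even a swap preserving
  -- `P` contradicts the choice of `R`.
  obtain ⟨R, hR, hRmin⟩ := Finset.exists_min_image
    (univ.filter fun S : Finset (Fin n) => P S = P M) (fun S => ∑ i ∈ S, i.val)
    ⟨M, by simp⟩
  have hRM : P R = P M := by simpa using hR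
  have hRle : ∀ S', P R ≤ P S' := fun S' => hRM ▸ hM S' (mem_univ _)
  have lower : ∀ i ∈ R, ∀ k, k < i → k ∈ R := by
    intro i hi k hk
    by_contra hkR
    have hke : k ∉ R.erase i := fun h => hkR (mem_of_mem_erase h)
    set β := ∑ j ∈ R.erase i, x j with hβ
    set γ := ∑ j ∈ R.erase i, x j ^ 2 with hγ
    have e1 : P R = (x i + β) ^ 2 - (1 + ρ) * (x i ^ 2 + γ) := by
      simp only [hP, hβ, hγ, Finset.add_sum_erase R x hi,
        Finset.add_sum_erase R (fun j => x j ^ 2) hi]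
    have e2 : P (R.erase i) = β ^ 2 - (1 + ρ) * γ := rfl
    have e3 : P (insert k (R.erase i)) = (x k + β) ^ 2 - (1 + ρ) * (x k ^ 2 + γ) := by
      simp only [hP, hβ, hγ, Finset.sum_insert hke]
    have hxi := hx i
    have hki : x i ≤ x k := hanti hk.le
    -- Deleting `i` cannot lower `P`; this makes replacing `x i` by the larger `x k` harmless.
    have h1 : 2 * β ≤ ρ * x i := by
      have := hRle (R.erase i)
      rw [e1, e2] at this
      by_contra! h
      nlinarith [mul_pos hxi (sub_pos.2 h)]
    have h2 : P (insert k (R.erase i)) ≤ P R := by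
      rw [e1, e3]
      have : 0 ≤ (x k - x i) * (ρ * (x i + x k) - 2 * β) :=
        mul_nonneg (by linarith) (by nlinarith [mul_nonneg hρ (hx k).le])
      nlinarith
    have h3 : P (insert k (R.erase i)) = P M := by
      rw [← hRM]; exact le_antisymm h2 (hRle _)
    have h4 := hRmin (insert k (R.erase i)) (by simpa using h3)
    simp only [Finset.sum_insert hke] at h4
    have h5 := Finset.add_sum_erase R (fun i : Fin n => i.val) hi
    have : k.val < i.val := hk
    omega
  rcases R.eq_empty_or_nonempty with h0 | hne
  · refine ⟨0, Nat.zero_le _, ?_⟩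
    have := hRle S
    subst h0
    simpa [hP] using this
  · refine ⟨(R.max' hne).val + 1, (R.max' hne).isLt, ?_⟩
    have hRe : (univ.filter fun i : Fin n => i.val < (R.max' hne).val + 1) = R := by
      ext i
      simp only [mem_filter, mem_univ, true_and]
      constructor
      · intro h
        rcases eq_or_lt_of_le (show i ≤ R.max' hne from Nat.lt_succ_iff.1 h) with h | h
        · rw [h]; exact R.max'_mem hne
        · exact lower _ (R.max'_mem hne) _ h
      · intro h
        exact Nat.lt_succ_of_le (R.le_max' i h)
    rw [hRe]
    exact hRle S

/-- The two-player estimate behind the pair ratio. -/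
theorem pair_estimate {ι : Type*} {x : ι → ℝ} (hx : ∀ i, 0 < x i) {r T : ℝ} (hr : 1 ≤ r)
    {a b : ι} (ha : ∀ i, x i ≤ x a) (hb : ∀ i, i ≠ a → x i ≤ x b) (hT : r ^ 2 * x a ^ 2 ≤ T)
    (hcase : r * x b ≤ x a ∨
      r ^ 2 * (x a ^ 2 + x b ^ 2) + x a ^ 2 ≤ T + 2 * r * (x a * x b))
    {i j : ι} (hij : i ≠ j) (hle : x j ≤ x i) (hlt : x i < r * x j) :
    r ^ 2 * (x i ^ 2 + x j ^ 2) + x i ^ 2 ≤ T + 2 * r * (x i * x j) := by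
  have hi := hx i
  have hj := hx j
  have hB := hx b
  have hA := hx a
  have hba : x b ≤ x a := ha b
  have hjb : x j ≤ x b := by
    by_cases h : j = a
    · have := hb i (by rw [← h]; exact hij)
      linarith
    · exact hb j h
  -- Below `x b` the diagonal value at `(x b, x b)` dominates; above it `i` must be `a`, and only `x
  -- j` varies.
  by_cases hib : x i ≤ x b
  · have hbb : x b ^ 2 * (1 + 2 * r ^ 2 - 2 * r) ≤ T := by
      rcases hcase with h | h
      · have h1 : r ^ 2 * x b ^ 2 ≤ x a ^ 2 := by
          have : (r * x b) ^ 2 ≤ x a ^ 2 := by gcongr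
          linarith [mul_pow r (x b) 2]
        have h2 : r ^ 2 * (r ^ 2 * x b ^ 2) ≤ r ^ 2 * x a ^ 2 := by gcongr
        have h3 : 0 ≤ x b ^ 2 * ((r ^ 2 - 1) ^ 2 + 2 * (r - 1)) := by
          apply mul_nonneg (sq_nonneg _); nlinarith [sq_nonneg (r ^ 2 - 1)]
        nlinarith
      · have : 0 ≤ (x a - x b) * ((1 + r ^ 2) * (x a + x b) - 2 * r * x b) := by
          apply mul_nonneg (by linarith)
          nlinarith [mul_nonneg (sq_nonneg (r - 1)) hB.le, mul_pos (pow_pos (by linarith : 0 < r) 2) hA]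
        nlinarith
    have h1 : 0 ≤ (x i - x j) * (r * (r * x j - x i) + r * ((r - 1) * x i)) := by
      apply mul_nonneg (by linarith)
      have : 0 ≤ r := by linarith
      have : 0 ≤ r - 1 := by linarith
      have : 0 ≤ r * x j - x i := by linarith
      positivity
    have h2 : x i ^ 2 * (1 + 2 * r ^ 2 - 2 * r) ≤ x b ^ 2 * (1 + 2 * r ^ 2 - 2 * r) := by
      have : 0 ≤ 1 + 2 * r ^ 2 - 2 * r := by nlinarith
      gcongr
    nlinarith
  · push Not at hib
    have hia : i = a := by
      by_contra h
      exact absurd (hb i h) (not_le.2 hib)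
    subst hia
    rcases hcase with h | h
    · nlinarith
    · have h1 : 0 ≤ (x b - x j) * (r * (r * x j - x i) + r * (r * x b - x i)) := by
        apply mul_nonneg (by linarith)
        have : 0 ≤ r := by linarith
        have : 0 ≤ r * x j - x i := by linarith
        have : 0 ≤ r * x b - x i := by nlinarith
        positivity
      nlinarith

/-- The conclusion minus `hF` is concave in `β`. Once the product `h1` is split off it decreases in
`β`, so `β = r * q - s` is the worst case (`h2`). What remains is concave in `s` on `[(2 - r) * q, r
* q / 2]`: `h3` removes the square, and `h4`, `h5` bound the linear rest by its value at the right
end. -/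
theorem tangent_estimate_two {r T q s β : ℝ} (hr1 : 1 ≤ r) (hr2 : r < 2)
    (hs : 0 < s) (hsβ : s ≤ β) (hsum : s + β < r * q) (hlarge : 2 * r * q < (1 + r ^ 2) * s)
    (hF : 0 ≤ (q + β) ^ 2 + T - (1 + r ^ 2) * (q ^ 2 + β ^ 2)) :
    0 ≤ 2 * (s + β) * (r * q) - (r * q) ^ 2 + T - (1 + r ^ 2) * (s ^ 2 + β ^ 2) := by
  have hq : 0 < q := by
    by_contra! h
    nlinarith
  have hs2 : (2 - r) * q ≤ s := by
    have h1 : (2 - r) * (1 + r ^ 2) ≤ 2 * r := by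
      nlinarith [mul_nonneg (sub_nonneg.2 hr1) (sq_nonneg (r - 1)), sq_nonneg (r - 1)]
    have h2 : (1 + r ^ 2) * ((2 - r) * q) ≤ (1 + r ^ 2) * s := by nlinarith
    exact le_of_mul_le_mul_left h2 (by positivity)
  have h1 : 0 ≤ (β - s) * (r * q - s - β) := mul_nonneg (by linarith) (by linarith)
  have h2 : 0 ≤ (2 - r) * q * (r * q - s - β) :=
    mul_nonneg (mul_nonneg (by linarith) hq.le) (by linarith)
  have h3 : 0 ≤ (2 + r ^ 2) * ((s - (2 - r) * q) * (r * q / 2 - s)) :=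
    mul_nonneg (by positivity) (mul_nonneg (by linarith) (by linarith))
  have h4 : 0 ≤ (2 - r) * (r ^ 2 / 2 - r + 1) * q * (r * q / 2 - s) := by
    refine mul_nonneg (mul_nonneg (mul_nonneg (by linarith) ?_) hq.le) (by linarith)
    nlinarith [sq_nonneg (r - 1)]
  have h5 : 0 ≤ q ^ 2 * (r / 2) * (2 - r) * (r ^ 2 / 2 + r - 1) := by
    refine mul_nonneg (mul_nonneg (mul_nonneg (sq_nonneg q) (by linarith)) (by linarith)) ?_
    nlinarith [sq_nonneg r]
  linarith

/-- Let `A` and `C` be the sums of `x` and `x²` over `S`. If the tangency point `r x_j` exceeds `A`,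
the tangent line bound at it is nonnegative. -/
theorem tangent_estimate {ι : Type*} [DecidableEq ι] {x : ι → ℝ} (hx : ∀ i, 0 < x i) {r T : ℝ}
    (hr : 1 ≤ r)
    (hF : ∀ S : Finset ι, 0 ≤ (∑ i ∈ S, x i) ^ 2 + T - (1 + r ^ 2) * ∑ i ∈ S, x i ^ 2)
    (hpair : ∀ i j, i ≠ j → x j ≤ x i → x i < r * x j →
      r ^ 2 * (x i ^ 2 + x j ^ 2) + x i ^ 2 ≤ T + 2 * r * (x i * x j))
    (j : ι) (S : Finset ι) (hj : j ∉ S) (hA : ∑ i ∈ S, x i < r * x j) :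
    0 ≤ 2 * (∑ i ∈ S, x i) * (r * x j) - (r * x j) ^ 2 + T -
      (1 + r ^ 2) * ∑ i ∈ S, x i ^ 2 := by
  have hq := hx j
  induction hc : S.card generalizing S with
  | zero =>
    rw [Finset.card_eq_zero] at hc
    subst hc
    have := hF {j}
    simp only [Finset.sum_singleton] at this
    simp only [Finset.sum_empty]
    nlinarith
  | succ c ih =>
    -- Such an `i` contributes a nonnegative amount, so it can be dropped from `S`.
    by_cases hsmall : ∃ i ∈ S, (1 + r ^ 2) * x i ≤ 2 * r * x j
    · obtain ⟨i, hi, hle⟩ := hsmall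
      have hxi := hx i
      have e1 := Finset.add_sum_erase S x hi
      have e2 := Finset.add_sum_erase S (fun i => x i ^ 2) hi
      have := ih (S.erase i) (fun h => hj (mem_of_mem_erase h)) (by linarith)
        (by rw [Finset.card_erase_of_mem hi, hc]; rfl)
      rw [← e1, ← e2]
      nlinarith [mul_nonneg hxi.le (sub_nonneg.2 hle)]
    push Not at hsmall
    set A := ∑ i ∈ S, x i with hAdef
    have hA0 : 0 ≤ A := Finset.sum_nonneg fun i _ => (hx i).le
    -- The target exceeds the subset inequality for `insert j S` by `A * (2 * (r - 1) * x j - A)`.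
    by_cases hAsmall : A ≤ 2 * (r - 1) * x j
    · have := hF (insert j S)
      rw [Finset.sum_insert hj, Finset.sum_insert hj] at this
      nlinarith [mul_nonneg hA0 (sub_nonneg.2 hAsmall)]
    push Not at hAsmall
    have hr2 : r < 2 := by
      by_contra! h
      nlinarith
    -- Every element now exceeds `2 * r * x j / (1 + r ^ 2)` while the sum stays below `r * x j`, so
    -- there are fewer than `(1 + r ^ 2) / 2 < 5 / 2` elements.
    obtain rfl | rfl | hc3 : c = 0 ∨ c = 1 ∨ 2 ≤ c := by omega
    · obtain ⟨i, rfl⟩ := Finset.card_eq_one.1 hc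
      have hij : i ≠ j := fun h => hj (by simp [h])
      simp only [Finset.sum_singleton] at hAdef ⊢
      have hl := hsmall i (by simp)
      have hxi := hx i
      rw [hAdef] at hA ⊢
      rcases le_total (x j) (x i) with h | h
      · nlinarith [hpair i j hij h hA]
      · have hlt : x j < r * x i := by
          by_contra! h'
          have h1 : 2 * r * (r * x i) ≤ 2 * r * x j := by gcongr
          nlinarith [mul_nonneg (mul_nonneg (sub_nonneg.2 hr) (by linarith : 0 ≤ r + 1)) hxi.le]
        nlinarith [hpair j i hij.symm h hlt]
    · obtain ⟨i, k, hik, hS⟩ : ∃ i k, i ≠ k ∧ S = {i, k} := Finset.card_eq_two.1 hc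
      wlog hle : x i ≤ x k generalizing i k
      · exact this k i hik.symm (by rw [hS, Finset.pair_comm]) (le_of_not_ge hle)
      have hjk : j ≠ k := fun h => hj (by simp [hS, h])
      have hF' := hF {j, k}
      rw [Finset.sum_pair hjk, Finset.sum_pair hjk] at hF'
      have hl := hsmall i (by simp [hS])
      rw [hAdef, hS, Finset.sum_pair hik] at hA ⊢
      rw [Finset.sum_pair hik]
      exact tangent_estimate_two hr hr2 (hx i) hle hA hl hF'
    · exfalso
      have h1 : (S.card : ℝ) * (2 * r * x j) ≤ (1 + r ^ 2) * A := by
        rw [hAdef, Finset.mul_sum, ← nsmul_eq_mul]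
        exact Finset.card_nsmul_le_sum _ _ _ fun i hi => (hsmall i hi).le
      have h2 : (3 : ℝ) ≤ S.card := by
        rw [hc]; exact_mod_cast (by omega : 3 ≤ c + 1)
      have hrq : 0 < r * x j := by positivity
      have h3 : 3 * (2 * r * x j) ≤ S.card * (2 * r * x j) :=
        mul_le_mul_of_nonneg_right h2 (by nlinarith)
      have h4 : (1 + r ^ 2) * A ≤ (1 + r ^ 2) * (r * x j) := by gcongr
      nlinarith

/-- The fractional knapsack bound: the fair total, scaled by `n`, dominates `r²` times the total of
any feasible utility vector. -/
theorem knapsack_bound {ι : Type*} [Fintype ι] [DecidableEq ι] {x : ι → ℝ} (hx : ∀ i, 0 < x i)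
    {r : ℝ} (hr : 1 ≤ r)
    (hF : ∀ S : Finset ι, 0 ≤ (∑ i ∈ S, x i) ^ 2 + ∑ i, x i ^ 2 - (1 + r ^ 2) * ∑ i ∈ S, x i ^ 2)
    (hpair : ∀ i j, i ≠ j → x j ≤ x i → x i < r * x j →
      r ^ 2 * (x i ^ 2 + x j ^ 2) + x i ^ 2 ≤ ∑ i, x i ^ 2 + 2 * r * (x i * x j))
    {b z : ι → ℝ} (hb : ∀ i, 1 ≤ b i) (hz : ∀ i, 0 ≤ z i) (hzb : ∀ i, z i * b i ≤ 1)
    (hsum : ∑ i, z i ≤ 1) :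
    r ^ 2 * ∑ i, x i ^ 2 * (z i * b i) ≤ ∑ i, x i ^ 2 * b i := by
  have hr0 : 0 < r := by linarith
  set S : Finset ι := univ.filter fun i => 1 < r ^ 2 * z i with hS
  set A := ∑ i ∈ S, x i with hA
  set T := ∑ i, x i ^ 2 with hT
  set C := ∑ i ∈ S, x i ^ 2 with hC
  -- `μ ^ 2` is the multiplier of `∑ z ≤ 1`. The unconstrained optimum is `μ = A`; otherwise the
  -- least `μ` allowed off `S` is used.
  obtain ⟨μ, hμ, hval⟩ : ∃ μ : ℝ, (∀ i ∉ S, r ^ 2 * x i ^ 2 ≤ μ ^ 2) ∧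
      0 ≤ 2 * A * μ - μ ^ 2 + T - (1 + r ^ 2) * C := by
    have hA0 : 0 ≤ A := Finset.sum_nonneg fun i _ => (hx i).le
    by_cases h : ∀ i ∉ S, r * x i ≤ A
    · refine ⟨A, fun i hi => ?_, by linarith [hF S]⟩
      rw [← mul_pow]
      have := hx i
      exact pow_le_pow_left₀ (by positivity) (h i hi) 2
    · push Not at h
      obtain ⟨i, hi, hAi⟩ := h
      obtain ⟨j, hj, hmax⟩ := Finset.exists_max_image Sᶜ x ⟨i, by simpa using hi⟩
      refine ⟨r * x j, fun k hk => ?_, ?_⟩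
      · rw [mul_pow]
        have := hx k
        have := hmax k (by simpa using hk)
        gcongr
      · have : x i ≤ x j := hmax i (by simpa using hi)
        exact tangent_estimate hx hr hF hpair j S (by simpa using hj) (by nlinarith)
  -- On `S`, `b i` is pushed up to `1 / z i` and `x² / z` is bounded by its tangent `2μx - μ²z`; off
  -- `S`, `b i` is pushed down to `1`.
  have key : ∀ i, (if i ∈ S then 2 * μ * x i - (1 + r ^ 2) * x i ^ 2 else 0) + x i ^ 2 -
      μ ^ 2 * z i ≤ x i ^ 2 * b i - r ^ 2 * (x i ^ 2 * (z i * b i)) := by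
    intro i
    have hxi := hx i
    have hbi := hb i
    by_cases hi : i ∈ S
    · simp only [hi, if_true]
      have h1 : 1 < r ^ 2 * z i := by simpa [hS] using hi
      have hzi : 0 < z i := by
        rcases (hz i).eq_or_lt with h | h
        · rw [← h] at h1; norm_num at h1
        · exact h
      have h2 : b i ≤ 1 / z i := by rw [le_div_iff₀ hzi, mul_comm]; exact hzb i
      have h3 : x i ^ 2 * ((1 / z i - b i) * (r ^ 2 * z i - 1)) ≥ 0 :=
        mul_nonneg (sq_nonneg _) (mul_nonneg (by linarith) (by linarith))
      have h4 : 0 ≤ (x i - μ * z i) ^ 2 / z i := by positivity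
      have h5 : (x i - μ * z i) ^ 2 / z i = x i ^ 2 * (1 / z i) - 2 * μ * x i + μ ^ 2 * z i := by
        field_simp; ring
      have h6 : x i ^ 2 * ((1 / z i - b i) * (r ^ 2 * z i - 1)) =
          r ^ 2 * x i ^ 2 - x i ^ 2 * (1 / z i) - r ^ 2 * (x i ^ 2 * (z i * b i)) +
            x i ^ 2 * b i := by
        field_simp; ring
      linarith
    · simp only [hi, if_false]
      have h1 : r ^ 2 * z i ≤ 1 := by simpa [hS] using hi
      have h2 := hμ i hi
      have h3 : 0 ≤ x i ^ 2 * ((b i - 1) * (1 - r ^ 2 * z i)) :=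
        mul_nonneg (sq_nonneg _) (mul_nonneg (by linarith) (by linarith))
      nlinarith [mul_le_mul_of_nonneg_right h2 (hz i)]
  have hs := Finset.sum_le_sum fun i (_ : i ∈ univ) => key i
  simp only [Finset.sum_add_distrib, Finset.sum_sub_distrib, ← Finset.mul_sum,
    Finset.sum_ite_mem, Finset.univ_inter] at hs
  rw [← hA, ← hT, ← hC] at hs
  have : μ ^ 2 * ∑ i, z i ≤ μ ^ 2 := mul_le_of_le_one_right (sq_nonneg _) hsum
  linarith


/-! ### Fair solutions and reduction of the price to the knapsack bound -/

/-- For every feasible choice of weights, the scaled fair total `∑ L b` is at least `ρ` times the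
total `∑ L z b` of the competing utility vector. -/
def KnapsackBound {n : ℕ} (L : Fin n → ℝ) (ρ : ℝ) : Prop :=
  ∀ b z : Fin n → ℝ, (∀ i, 1 ≤ b i) → (∀ i, 0 ≤ z i) → (∀ i, z i * b i ≤ 1) → ∑ i, z i ≤ 1 →
    ρ * ∑ i, L i * (z i * b i) ≤ ∑ i, L i * b i

namespace IsUtilitySet

variable {n : ℕ} {L : Fin n → ℝ} {U : Set (Fin n → ℝ)}

theorem le_of_mem (hU : IsUtilitySet L U) {u : Fin n → ℝ} (hu : u ∈ U) (i : Fin n) : u i ≤ L i :=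
  (hU.isGreatest i).2 ⟨u, hu, rfl⟩

theorem single_mem (hU : IsUtilitySet L U) (i : Fin n) : Pi.single i (L i) ∈ U := by
  obtain ⟨u, hu, hui⟩ := (hU.isGreatest i).1
  have h0 := hU.nonneg u hu
  simp only at hui
  refine hU.monotone u hu _ (Pi.single_nonneg.2 (hui ▸ h0 i)) fun j => ?_
  by_cases h : j = i
  · subst h; simp [hui]
  · simpa [h] using h0 j

theorem exists_pos_mem (hU : IsUtilitySet L U) (hn : 0 < n) (hL : ∀ i, 0 < L i) :
    ∃ w ∈ U, ∀ i, 0 < w i := by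
  have hn' : (0 : ℝ) < n := by exact_mod_cast hn
  refine ⟨∑ i, (n : ℝ)⁻¹ • Pi.single i (L i),
    hU.convex.sum_mem (fun _ _ => by positivity) (by simp [hn'.ne']) fun i _ => hU.single_mem i,
    fun i => ?_⟩
  have : (∑ j, (n : ℝ)⁻¹ • (Pi.single j (L j) : Fin n → ℝ)) i = (n : ℝ)⁻¹ * L i := by
    simp [Finset.sum_apply, Pi.single_apply]
  rw [this]
  have := hL i
  positivity

theorem exists_isUtilitarian (hU : IsUtilitySet L U) (hn : 0 < n) (hL : ∀ i, 0 < L i) :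
    ∃ u, IsUtilitarian U u := by
  obtain ⟨w, hw, -⟩ := hU.exists_pos_mem hn hL
  obtain ⟨u, hu, hmax⟩ := hU.isCompact.exists_isMaxOn ⟨w, hw⟩
    (f := fun u : Fin n → ℝ => ∑ i, u i) (by fun_prop)
  exact ⟨u, hu, fun v hv => hmax hv⟩

/-- A maximizer of the Nash product is proportionally fair. -/
theorem exists_isPropFair (hU : IsUtilitySet L U) (hn : 0 < n) (hL : ∀ i, 0 < L i) :
    ∃ u, IsPropFair U u := by
  obtain ⟨w, hw, hwpos⟩ := hU.exists_pos_mem hn hL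
  obtain ⟨u, hu, hmax⟩ := hU.isCompact.exists_isMaxOn ⟨w, hw⟩
    (f := fun u : Fin n → ℝ => ∏ i, u i) (by fun_prop)
  have hprod : 0 < ∏ i, u i := (Finset.prod_pos fun i _ => hwpos i).trans_le (hmax hw)
  have hpos : ∀ i, 0 < u i := fun i =>
    lt_of_le_of_ne (hU.nonneg u hu i) fun h =>
      hprod.ne' (Finset.prod_eq_zero (mem_univ i) h.symm)
  refine ⟨u, hu, hpos, fun v hv => ?_⟩
  set f : ℝ → ℝ := fun t => ∏ i, (u i + t * (v i - u i)) with hf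
  have hderiv : HasDerivAt f ((∏ i, u i) * ∑ i, (v i - u i) / u i) 0 := by
    have h1 : ∀ i ∈ (univ : Finset (Fin n)),
        HasDerivAt (fun t : ℝ => u i + t * (v i - u i)) (v i - u i) 0 := fun i _ => by
      simpa using ((hasDerivAt_id (0 : ℝ)).mul_const (v i - u i)).const_add (u i)
    have h2 : ∑ i, (∏ j ∈ univ.erase i, (u j + 0 * (v j - u j))) • (v i - u i) =
        (∏ i, u i) * ∑ i, (v i - u i) / u i := by
      rw [Finset.mul_sum]
      refine Finset.sum_congr rfl fun i hi => ?_
      have := (hpos i).ne'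
      simp only [zero_mul, add_zero, smul_eq_mul]
      rw [← Finset.mul_prod_erase univ u hi]
      field_simp
    exact h2 ▸ HasDerivAt.fun_finsetProd h1
  have hle : (∏ i, u i) * ∑ i, (v i - u i) / u i ≤ 0 := by
    refine le_of_tendsto hderiv.tendsto_slope_zero_right ?_
    filter_upwards [Ioo_mem_nhdsGT (zero_lt_one' ℝ)] with t ht
    have hmem : (fun i => u i + t * (v i - u i)) ∈ U := by
      have := hU.convex hu hv (sub_nonneg.2 ht.2.le) ht.1.le (by ring)
      convert this using 1
      ext i
      simp only [Pi.add_apply, Pi.smul_apply, smul_eq_mul]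
      ring
    have h3 : f t ≤ f 0 := by
      have := hmax hmem
      simpa [hf] using this
    rw [zero_add, smul_eq_mul]
    exact mul_nonpos_of_nonneg_of_nonpos (inv_nonneg.2 ht.1.le) (sub_nonpos.2 h3)
  exact nonpos_of_mul_nonpos_right hle hprod

end IsUtilitySet

theorem IsPropFair.sum_div_le {n : ℕ} {U : Set (Fin n → ℝ)} {u v : Fin n → ℝ}
    (hu : IsPropFair U u) (hv : v ∈ U) : ∑ i, v i / u i ≤ n := by
  have h := hu.2.2 v hv
  have h1 : ∀ i, (v i - u i) / u i = v i / u i - 1 := fun i => by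
    rw [sub_div, div_self (hu.2.1 i).ne']
  simp only [h1, Finset.sum_sub_distrib, Finset.sum_const, Finset.card_univ, Fintype.card_fin,
    nsmul_eq_mul, mul_one] at h
  linarith

/-- Testing each solution against the other gives `∑ (v / u + u / v) ≤ 2n`, while each summand is at
least `2`, with equality only for `u i = v i`. -/
theorem IsPropFair.unique {n : ℕ} {U : Set (Fin n → ℝ)} {u v : Fin n → ℝ}
    (hu : IsPropFair U u) (hv : IsPropFair U v) : u = v := by
  have h1 := hu.sum_div_le hv.1
  have h2 := hv.sum_div_le hu.1
  have e : ∀ i, v i / u i + u i / v i - 2 = (u i - v i) ^ 2 / (u i * v i) := fun i => by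
    have := (hu.2.1 i).ne'
    have := (hv.2.1 i).ne'
    field_simp
    ring
  have hnn : ∀ i ∈ (univ : Finset (Fin n)), 0 ≤ (u i - v i) ^ 2 / (u i * v i) := fun i _ => by
    have := hu.2.1 i
    have := hv.2.1 i
    positivity
  have hs : ∑ i, (u i - v i) ^ 2 / (u i * v i) = 0 := by
    refine le_antisymm ?_ (Finset.sum_nonneg hnn)
    simp only [← e, Finset.sum_sub_distrib, Finset.sum_add_distrib, Finset.sum_const,
      Finset.card_univ, Fintype.card_fin, nsmul_eq_mul]
    linarith
  ext i
  have h0 := (Finset.sum_eq_zero_iff_of_nonneg hnn).1 hs i (mem_univ i)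
  have hpos : u i * v i ≠ 0 := (mul_pos (hu.2.1 i) (hv.2.1 i)).ne'
  have h3 : (u i - v i) ^ 2 = 0 := by simpa [hpos, (hu.2.1 i).ne', (hv.2.1 i).ne'] using h0
  exact sub_eq_zero.1 (pow_eq_zero_iff two_ne_zero |>.1 h3)

namespace IsUtilitySet

variable {n : ℕ} {L : Fin n → ℝ} {U : Set (Fin n → ℝ)}

theorem existsUnique_price (hU : IsUtilitySet L U) (hn : 0 < n) (hL : ∀ i, 0 < L i) :
    ∃! p : ℝ, IsPriceOfPropFairness U p := by
  obtain ⟨u, hu⟩ := hU.exists_isUtilitarian hn hL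
  obtain ⟨a, ha⟩ := hU.exists_isPropFair hn hL
  refine ⟨_, ⟨u, a, hu, ha, rfl⟩, ?_⟩
  rintro p ⟨u', a', hu', ha', rfl⟩
  rw [ha'.unique ha, le_antisymm (hu.2 _ hu'.1) (hu'.2 _ hu.1)]

theorem price_le (hU : IsUtilitySet L U) (hn : 0 < n) (hL : ∀ i, 0 < L i) {ρ : ℝ}
    (hK : KnapsackBound L ρ) {p : ℝ} (hp : IsPriceOfPropFairness U p) : p ≤ 1 - ρ / n := by
  obtain ⟨v, a, hv, ha, rfl⟩ := hp
  have hn' : (0 : ℝ) < n := by exact_mod_cast hn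
  have hapos := ha.2.1
  have hsumv : 0 < ∑ i, v i := by
    have : (0 : ℝ) < ∑ i, a i := Finset.sum_pos (fun i _ => hapos i) ⟨⟨0, hn⟩, mem_univ _⟩
    exact this.trans_le (hv.2 a ha.1)
  have hvnn := hU.nonneg v hv.1
  have e : ∀ i, v i / (n * a i) * (n * a i / L i) = v i / L i := fun i => by
    have := (hapos i).ne'
    have := (hL i).ne'
    field_simp
  have h := hK (fun i => n * a i / L i) (fun i => v i / (n * a i)) ?_ ?_ ?_ ?_
  · simp only [e] at h
    have e1 : ∀ i, L i * (v i / L i) = v i := fun i => mul_div_cancel₀ _ (hL i).ne'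
    have e2 : ∀ i, L i * (n * a i / L i) = n * a i := fun i => mul_div_cancel₀ _ (hL i).ne'
    simp only [e1, e2, ← Finset.mul_sum] at h
    rw [sub_div, div_self hsumv.ne']
    have : ρ / n ≤ (∑ i, a i) / ∑ i, v i := by
      rw [div_le_div_iff₀ hn' hsumv]; linarith
    linarith
  · intro i
    have h1 := ha.sum_div_le (hU.single_mem i)
    have h2 : ∀ j, (Pi.single i (L i) : Fin n → ℝ) j / a j = if j = i then L i / a i else 0 := by
      intro j
      by_cases h : j = i
      · subst h; simp
      · simp [h]
    simp only [h2, Finset.sum_ite_eq', mem_univ, if_true] at h1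
    rw [div_le_iff₀ (hapos i)] at h1
    rw [one_le_div (hL i)]
    exact h1
  · intro i
    exact div_nonneg (hvnn i) (mul_nonneg hn'.le (hapos i).le)
  · intro i
    simp only [e]
    exact (div_le_one (hL i)).2 (hU.le_of_mem hv.1 i)
  · have h1 := ha.sum_div_le hv.1
    have h2 : ∀ i, v i / (n * a i) = (n : ℝ)⁻¹ * (v i / a i) := fun i => by
      rw [mul_comm (n : ℝ), ← div_div]; ring
    simp only [h2, ← Finset.mul_sum]
    rw [inv_mul_le_iff₀ hn']
    simpa using h1

end IsUtilitySet

/-! ### Extremal utility sets: boxes cut by one hyperplane -/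

theorem isUtilitySet_truncatedSimplex {n : ℕ} {L : Fin n → ℝ} (hL : ∀ i, 0 < L i)
    {b : Fin n → ℝ} (hb : ∀ i, 1 ≤ b i) :
    IsUtilitySet L {u | u ∈ Set.Icc 0 L ∧ ∑ i, u i / (L i * b i) ≤ 1} := by
  have hLb : ∀ i, 0 < L i * b i := fun i => mul_pos (hL i) (by linarith [hb i])
  refine ⟨?_, ?_, fun u hu => hu.1.1, ?_, fun i => ⟨⟨Pi.single i (L i), ⟨⟨?_, ?_⟩, ?_⟩, by simp⟩, ?_⟩⟩
  · have hclosed : IsClosed {u : Fin n → ℝ | ∑ i, u i / (L i * b i) ≤ 1} :=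
      isClosed_le (by fun_prop) continuous_const
    exact isCompact_Icc.inter_right hclosed
  · intro u hu v hv s t hs ht hst
    refine ⟨convex_Icc 0 L hu.1 hv.1 hs ht hst, ?_⟩
    have e : ∀ i, (s • u + t • v) i / (L i * b i) =
        s * (u i / (L i * b i)) + t * (v i / (L i * b i)) := fun i => by
      simp only [Pi.add_apply, Pi.smul_apply, smul_eq_mul]; ring
    simp only [e, Finset.sum_add_distrib, ← Finset.mul_sum]
    calc _ ≤ s * 1 + t * 1 := by
          gcongr
          · exact hu.2
          · exact hv.2
      _ = 1 := by linarith
  · intro u hu v hv hvu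
    refine ⟨⟨hv, hvu.trans hu.1.2⟩, le_trans ?_ hu.2⟩
    exact Finset.sum_le_sum fun i _ => div_le_div_of_nonneg_right (hvu i) (hLb i).le
  · exact Pi.single_nonneg.2 (hL i).le
  · intro j
    by_cases h : j = i
    · subst h; simp
    · simpa [h] using (hL j).le
  · have h2 : ∀ j, (Pi.single i (L i) : Fin n → ℝ) j / (L j * b j) =
        if j = i then 1 / b i else 0 := by
      intro j
      by_cases h : j = i
      · subst h
        have := (hL j).ne'
        have : b j ≠ 0 := by linarith [hb j]
        simp only [Pi.single_eq_same, if_true]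
        field_simp
      · simp [h]
    simp only [h2, Finset.sum_ite_eq', mem_univ, if_true]
    rw [div_le_one (by linarith [hb i])]
    exact hb i
  · rintro _ ⟨u, hu, rfl⟩
    exact hu.1.2 i

/-- If the knapsack bound is attained by weights `b` and a vector with relative utilities `y`, then
some utility set attains the corresponding price of fairness. -/
theorem KnapsackBound.exists_price_eq {n : ℕ} (hn : 0 < n) {L : Fin n → ℝ} (hL : ∀ i, 0 < L i)
    {ρ : ℝ} (hρ : 0 < ρ) (hK : KnapsackBound L ρ) {b y : Fin n → ℝ} (hb : ∀ i, 1 ≤ b i)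
    (hbn : ∀ i, b i ≤ n) (hy : ∀ i, 0 ≤ y i) (hy1 : ∀ i, y i ≤ 1) (hyb : ∑ i, y i / b i ≤ 1)
    (heq : ∑ i, L i * b i = ρ * ∑ i, L i * y i) :
    ∃ U : Set (Fin n → ℝ), IsUtilitySet L U ∧ IsPriceOfPropFairness U (1 - ρ / n) := by
  have hn' : (0 : ℝ) < n := by exact_mod_cast hn
  have hbpos : ∀ i, 0 < b i := fun i => by linarith [hb i]
  have hLb : ∀ i, 0 < L i * b i := fun i => mul_pos (hL i) (hbpos i)
  refine ⟨_, isUtilitySet_truncatedSimplex hL hb, fun i => L i * y i, fun i => L i * b i / n,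
    ⟨⟨⟨fun i => mul_nonneg (hL i).le (hy i), fun i => mul_le_of_le_one_right (hL i).le (hy1 i)⟩, ?_⟩,
      ?_⟩, ⟨⟨⟨fun i => (div_pos (hLb i) hn').le, fun i => ?_⟩, ?_⟩, fun i => div_pos (hLb i) hn', ?_⟩, ?_⟩
  · refine le_trans (le_of_eq (Finset.sum_congr rfl fun i _ => ?_)) hyb
    exact mul_div_mul_left _ _ (hL i).ne'
  · intro v hv
    have h := hK b (fun i => v i / (L i * b i)) hb (fun i => div_nonneg (hv.1.1 i) (hLb i).le)
      (fun i => ?_) hv.2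
    · have e : ∀ i, L i * (v i / (L i * b i) * b i) = v i := fun i => by
        have := (hL i).ne'
        have := (hbpos i).ne'
        field_simp
      simp only [e] at h
      rw [heq] at h
      exact le_of_mul_le_mul_left h hρ
    · have e : v i / (L i * b i) * b i = v i / L i := by
        have := (hL i).ne'
        have := (hbpos i).ne'
        field_simp
      rw [e, div_le_one (hL i)]
      exact hv.1.2 i
  · simp only
    rw [div_le_iff₀ hn']
    exact mul_le_mul_of_nonneg_left (hbn i) (hL i).le
  · have e : ∀ i, L i * b i / n / (L i * b i) = (n : ℝ)⁻¹ := fun i => by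
      have := (hL i).ne'
      have := (hbpos i).ne'
      field_simp
    simp only [e, Finset.sum_const, Finset.card_univ, Fintype.card_fin, nsmul_eq_mul]
    rw [mul_inv_cancel₀ hn'.ne']
  · intro v hv
    have e : ∀ i, (v i - L i * b i / n) / (L i * b i / n) = n * (v i / (L i * b i)) - 1 := fun i => by
      have := (hL i).ne'
      have := (hbpos i).ne'
      field_simp
    simp only [e, Finset.sum_sub_distrib, ← Finset.mul_sum, Finset.sum_const, Finset.card_univ,
      Fintype.card_fin, nsmul_eq_mul, mul_one]
    have := mul_le_mul_of_nonneg_left hv.2 hn'.le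
    linarith
  · have hpos : 0 < ∑ i, L i * b i := Finset.sum_pos (fun i _ => hLb i) ⟨⟨0, hn⟩, mem_univ _⟩
    rw [heq] at hpos
    have hne : ∑ i, L i * y i ≠ 0 := (pos_of_mul_pos_right hpos hρ.le).ne'
    rw [← Finset.sum_div, heq]
    field_simp


/-- The first alternative of `hcase` leaves no relevant pair with larger player `a`; the second is
the pair inequality for the two largest players. -/
theorem knapsackBound_of_subset_of_pair {n : ℕ} {L x : Fin n → ℝ} (hx : ∀ i, 0 < x i)
    (hxL : ∀ i, x i ^ 2 = L i) {r : ℝ} (hr : 1 ≤ r)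
    (hF : ∀ S : Finset (Fin n),
      0 ≤ (∑ i ∈ S, x i) ^ 2 + ∑ i, x i ^ 2 - (1 + r ^ 2) * ∑ i ∈ S, x i ^ 2)
    {a b : Fin n} (ha : ∀ i, x i ≤ x a) (hb : ∀ i, i ≠ a → x i ≤ x b)
    (hcase : r * x b ≤ x a ∨
      r ^ 2 * (x a ^ 2 + x b ^ 2) + x a ^ 2 ≤ ∑ i, x i ^ 2 + 2 * r * (x a * x b)) :
    KnapsackBound L (r ^ 2) := by
  have hT : r ^ 2 * x a ^ 2 ≤ ∑ i, x i ^ 2 := by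
    have := hF {a}
    simp only [Finset.sum_singleton] at this
    linarith
  intro w z hw hz hzw hsum
  have := knapsack_bound hx hr hF
    (fun i j hij hle hlt => pair_estimate hx hr ha hb hT hcase hij hle hlt) hw hz hzw hsum
  simpa only [hxL] using this

/-- A set of players at which the subset inequality is an equality yields a tight utility set. -/
theorem exists_price_eq_of_subset {n : ℕ} (hn : 2 ≤ n) {L x : Fin n → ℝ} (hx : ∀ i, 0 < x i)
    (hxL : ∀ i, x i ^ 2 = L i) {ρ : ℝ} (hρ : 0 < ρ)
    (hF : ∀ S : Finset (Fin n),
      0 ≤ (∑ i ∈ S, x i) ^ 2 + ∑ i, x i ^ 2 - (1 + ρ) * ∑ i ∈ S, x i ^ 2)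
    (hK : KnapsackBound L ρ) {S : Finset (Fin n)} (hS : S.Nonempty)
    (heq : (∑ i ∈ S, x i) ^ 2 + ∑ i, x i ^ 2 - (1 + ρ) * ∑ i ∈ S, x i ^ 2 = 0) :
    ∃ U : Set (Fin n → ℝ), IsUtilitySet L U ∧ IsPriceOfPropFairness U (1 - ρ / n) := by
  have hn0 : 0 < n := by omega
  have hn2 : (2 : ℝ) ≤ n := by exact_mod_cast hn
  have hL : ∀ i, 0 < L i := fun i => hxL i ▸ pow_pos (hx i) 2
  set A := ∑ i ∈ S, x i with hA
  have hApos : 0 < A := Finset.sum_pos (fun i _ => hx i) hS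
  have hxA : ∀ i ∈ S, x i ≤ A := fun i hi =>
    Finset.single_le_sum (f := x) (fun j _ => (hx j).le) hi
  have hρn : ρ ≤ n := by
    have h1 := hF univ
    have h2 : (∑ i, x i) ^ 2 ≤ n * ∑ i, x i ^ 2 := by
      simpa using sq_sum_le_card_mul_sum_sq (s := univ) (f := x)
    have h3 : 0 < ∑ i, x i ^ 2 :=
      Finset.sum_pos (fun i _ => pow_pos (hx i) 2) ⟨⟨0, hn0⟩, mem_univ _⟩
    refine le_of_mul_le_mul_right ?_ h3
    linarith
  -- Equality in the tangent bound with `μ = A` forces `z i = x i / A` on `S`, and `b i = 1 / z i`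
  -- there.
  refine hK.exists_price_eq hn0 hL hρ (b := fun i => if i ∈ S then A / x i else 1)
    (y := fun i => if i ∈ S then 1 else 0) ?_ ?_ ?_ ?_ ?_ ?_
  · intro i
    split_ifs with hi
    · exact (one_le_div (hx i)).2 (hxA i hi)
    · exact le_rfl
  · intro i
    split_ifs with hi
    -- Comparing `S` with `S.erase i` gives `A / x i ≤ 1 + ρ / 2 ≤ 1 + n / 2 ≤ n`.
    · have h1 := hF (S.erase i)
      have e1 := Finset.add_sum_erase S x hi
      have e2 := Finset.add_sum_erase S (fun i => x i ^ 2) hi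
      have hxi := hx i
      rw [← e2] at heq
      rw [← hA] at e1
      have h2 : 2 * (A - x i) ≤ ρ * x i := by
        rw [show ∑ j ∈ S.erase i, x j = A - x i by linarith] at h1
        refine le_of_mul_le_mul_left ?_ hxi
        linarith
      rw [div_le_iff₀ hxi]
      nlinarith
    · linarith
  · intro i
    split_ifs <;> norm_num
  · intro i
    split_ifs <;> norm_num
  · have e : ∀ i, (if i ∈ S then (1 : ℝ) else 0) / (if i ∈ S then A / x i else 1) =
        if i ∈ S then x i / A else 0 := fun i => by split_ifs <;> simp
    simp only [e, Finset.sum_ite_mem, Finset.univ_inter, ← Finset.sum_div]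
    rw [← hA, div_self hApos.ne']
  · have e : ∀ i, L i * (if i ∈ S then A / x i else 1) =
        x i ^ 2 + if i ∈ S then A * x i - x i ^ 2 else 0 := fun i => by
      have := (hx i).ne'
      rw [← hxL]
      split_ifs
      · field_simp; ring
      · ring
    simp only [e]
    simp only [← hxL, mul_ite, mul_one, mul_zero, Finset.sum_add_distrib, Finset.sum_ite_mem,
      Finset.univ_inter, Finset.sum_sub_distrib, ← Finset.mul_sum]
    rw [← hA]
    linarith

/-- If the pair inequality is an equality, then filling player `a` and giving the rest of the
capacity to player `b` yields a tight utility set. -/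
theorem exists_price_eq_of_pair {n : ℕ} {L x : Fin n → ℝ} (hx : ∀ i, 0 < x i)
    (hxL : ∀ i, x i ^ 2 = L i) {r : ℝ} (hr : 1 ≤ r) (hK : KnapsackBound L (r ^ 2))
    {a b : Fin n} (hab : a ≠ b) (hba : x b ≤ x a) (hle : x a ≤ r * x b) (hrn : r ^ 2 ≤ n)
    (heq : r ^ 2 * (x a ^ 2 + x b ^ 2) + x a ^ 2 = ∑ i, x i ^ 2 + 2 * r * (x a * x b)) :
    ∃ U : Set (Fin n → ℝ), IsUtilitySet L U ∧ IsPriceOfPropFairness U (1 - r ^ 2 / n) := by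
  have hL : ∀ i, 0 < L i := fun i => hxL i ▸ pow_pos (hx i) 2
  have hxa := hx a
  have hxb := hx b
  have hr0 : 0 < r := by linarith
  have hw0 : 0 < x a / (r * x b) := by positivity
  have hw1 : x a / (r * x b) ≤ 1 := (div_le_one (by positivity)).2 hle
  have hrn' : r ≤ n := by nlinarith
  -- Here `μ = r * x b`: player `a` uses capacity `x a / μ`, and `b` takes the rest at weight `1`.
  refine hK.exists_price_eq (Fin.pos a) hL (by positivity)
    (b := fun i => if i = a then r * x b / x a else 1)
    (y := fun i => if i = a then 1 else if i = b then 1 - x a / (r * x b) else 0) ?_ ?_ ?_ ?_ ?_ ?_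
  · intro i
    split_ifs
    · exact (one_le_div hxa).2 hle
    · exact le_rfl
  · intro i
    split_ifs
    · rw [div_le_iff₀ hxa]
      nlinarith
    · linarith
  · intro i
    split_ifs <;> linarith
  · intro i
    split_ifs <;> linarith
  · have e : ∀ i, (if i = a then (1 : ℝ) else if i = b then 1 - x a / (r * x b) else 0) /
        (if i = a then r * x b / x a else 1) =
        (if i = a then x a / (r * x b) else 0) + if i = b then 1 - x a / (r * x b) else 0 := by
      intro i
      by_cases h : i = a
      · subst h; simp [hab]
      · simp [h]
    simp only [e, Finset.sum_add_distrib, Finset.sum_ite_eq', mem_univ, if_true]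
    linarith
  · have e1 : ∀ i, L i * (if i = a then r * x b / x a else 1) =
        x i ^ 2 + if i = a then r * (x a * x b) - x a ^ 2 else 0 := fun i => by
      rw [← hxL]
      split_ifs with h
      · subst h; field_simp; ring
      · ring
    have e2 : ∀ i, L i * (if i = a then (1 : ℝ) else if i = b then 1 - x a / (r * x b) else 0) =
        (if i = a then x a ^ 2 else 0) + if i = b then x b ^ 2 - x a * x b / r else 0 := fun i => by
      rw [← hxL]
      by_cases h : i = a
      · subst h; simp [hab]
      · by_cases h' : i = b
        · subst h'; simp only [h, if_false, if_true, zero_add]; field_simp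
        · simp [h, h']
    simp only [e1, e2, Finset.sum_add_distrib, Finset.sum_ite_eq', mem_univ, if_true]
    have e3 : r ^ 2 * (x a ^ 2 + (x b ^ 2 - x a * x b / r)) =
        r ^ 2 * (x a ^ 2 + x b ^ 2) - r * (x a * x b) := by
      field_simp; ring
    rw [e3]
    linarith

/-! ### The ratios `m(L)` and `t(L)` as equality cases -/

section ratios

variable {n : ℕ} {L : Fin n → ℝ}

theorem sum_filter_lt_add_sum_filter_le (f : Fin n → ℝ) (l : ℕ) :
    (∑ i : Fin n with i.val < l, f i) + ∑ i : Fin n with l ≤ i.val, f i = ∑ i, f i := by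
  rw [← Finset.sum_filter_add_sum_filter_not univ (fun i : Fin n => i.val < l) f]
  simp only [not_lt]

theorem sum_filter_lt_pos (hL : ∀ i, 0 < L i) (hn : 0 < n) {l : ℕ} (hl : 1 ≤ l) :
    0 < ∑ i : Fin n with i.val < l, L i :=
  Finset.sum_pos (fun i _ => hL i) ⟨⟨0, hn⟩, by simp; omega⟩

theorem natCast_mul_prefixRatio (hn : 0 < n) (l : ℕ) :
    n * prefixRatio L l = ((∑ i : Fin n with i.val < l, √(L i)) ^ 2 + ∑ i, L i -
      ∑ i : Fin n with i.val < l, L i) / ∑ i : Fin n with i.val < l, L i := by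
  have hn' : (n : ℝ) ≠ 0 := by exact_mod_cast hn.ne'
  rw [prefixRatio, ← sum_filter_lt_add_sum_filter_le L l, ← mul_div_assoc, mul_div_mul_left _ _ hn']
  congr 1
  ring

theorem one_le_natCast_mul_prefixRatio (hL : ∀ i, 0 < L i) (hn : 0 < n) {l : ℕ} (hl : 1 ≤ l) :
    1 ≤ n * prefixRatio L l := by
  rw [natCast_mul_prefixRatio hn, one_le_div (sum_filter_lt_pos hL hn hl)]
  have h1 : ∑ i : Fin n with i.val < l, L i ≤ (∑ i : Fin n with i.val < l, √(L i)) ^ 2 := by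
    calc _ = ∑ i : Fin n with i.val < l, √(L i) ^ 2 :=
          Finset.sum_congr rfl fun i _ => (Real.sq_sqrt (hL i).le).symm
      _ ≤ _ := Finset.sum_sq_le_sq_sum_of_nonneg fun i _ => Real.sqrt_nonneg _
  have h2 : ∑ i : Fin n with i.val < l, L i ≤ ∑ i, L i :=
    Finset.sum_le_sum_of_subset_of_nonneg (Finset.filter_subset _ _) fun i _ _ => (hL i).le
  linarith

theorem subset_estimate (hL : ∀ i, 0 < L i) (hanti : Antitone L) (hn : 0 < n) {ρ : ℝ}
    (hρ0 : 0 ≤ ρ) (hρ : ∀ l, 1 ≤ l → l ≤ n → ρ ≤ n * prefixRatio L l) (S : Finset (Fin n)) :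
    0 ≤ (∑ i ∈ S, √(L i)) ^ 2 + ∑ i, √(L i) ^ 2 - (1 + ρ) * ∑ i ∈ S, √(L i) ^ 2 := by
  have hx : ∀ i, 0 < √(L i) := fun i => Real.sqrt_pos.2 (hL i)
  obtain ⟨l, hln, hl⟩ := exists_prefix_le hx (fun i j h => Real.sqrt_le_sqrt (hanti h)) hρ0 S
  have hsq : ∀ i, √(L i) ^ 2 = L i := fun i => Real.sq_sqrt (hL i).le
  have hT : 0 ≤ ∑ i, L i := Finset.sum_nonneg fun i _ => (hL i).le
  simp only [hsq] at hl ⊢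
  rcases Nat.eq_zero_or_pos l with rfl | hlpos
  · simp at hl
    linarith
  · have := hρ l hlpos hln
    rw [natCast_mul_prefixRatio hn, le_div_iff₀ (sum_filter_lt_pos hL hn hlpos)] at this
    linarith

theorem le_natCast_mul_prefixRatio {hn : 2 ≤ n} {ρ : ℝ} (hρ : ρ ≤ n * minPrefixRatio hn L) (l : ℕ)
    (hl : 1 ≤ l) (hln : l ≤ n) : ρ ≤ n * prefixRatio L l :=
  hρ.trans (mul_le_mul_of_nonneg_left
    (Finset.inf'_le (prefixRatio L) (Finset.mem_Icc.2 ⟨hl, hln⟩)) (Nat.cast_nonneg n))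

theorem exists_minPrefixRatio_eq (hn : 2 ≤ n) (L : Fin n → ℝ) :
    ∃ l, 1 ≤ l ∧ minPrefixRatio hn L = prefixRatio L l := by
  obtain ⟨l, hl, h⟩ := Finset.exists_mem_eq_inf' (s := Finset.Icc 1 n)
    (Finset.nonempty_Icc.mpr (by omega)) (prefixRatio L)
  exact ⟨l, (Finset.mem_Icc.1 hl).1, h⟩

theorem exists_price_eq_minPrefixRatio (hn : 2 ≤ n) (hL : ∀ i, 0 < L i) (hanti : Antitone L)
    (hK : KnapsackBound L (n * minPrefixRatio hn L)) :
    ∃ U : Set (Fin n → ℝ), IsUtilitySet L U ∧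
      IsPriceOfPropFairness U (1 - minPrefixRatio hn L) := by
  have hn0 : 0 < n := by omega
  have hn' : (n : ℝ) ≠ 0 := by exact_mod_cast hn0.ne'
  obtain ⟨l, hl, hml⟩ := exists_minPrefixRatio_eq hn L
  have h1 := one_le_natCast_mul_prefixRatio hL hn0 hl
  have hC := sum_filter_lt_pos hL hn0 hl
  rw [← hml] at h1
  have h := exists_price_eq_of_subset hn (fun i => Real.sqrt_pos.2 (hL i))
    (fun i => Real.sq_sqrt (hL i).le) (by linarith)
    (subset_estimate hL hanti hn0 (by linarith) (le_natCast_mul_prefixRatio le_rfl)) hK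
    (S := univ.filter fun i : Fin n => i.val < l) ⟨⟨0, hn0⟩, by simp; omega⟩ ?_
  · rwa [mul_div_cancel_left₀ _ hn'] at h
  · have e := natCast_mul_prefixRatio (L := L) hn0 l
    rw [← hml, eq_div_iff hC.ne'] at e
    simp only [Real.sq_sqrt (hL _).le]
    linarith

end ratios

/-- If `t < 1`, monotonicity of the quadratic to the right of its vertex gives `2pq + R < p²`. Then
`2q ≤ p` and `q² + R ≤ p²`, so `hcase` would yield `p⁴ < 2p²q² ≤ p⁴ / 2`. -/
theorem one_le_of_pair_equation {p q R t : ℝ} (hp : 0 < p) (hq : 0 < q) (hR : 0 ≤ R) (hqp : q ≤ p)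
    (hcase : p ^ 4 < (p ^ 2 + q ^ 2 + R) * q ^ 2) (ht : 0 ≤ t * (p ^ 2 + q ^ 2) - p * q)
    (heq : t ^ 2 * (p ^ 2 + q ^ 2) + p ^ 2 = p ^ 2 + q ^ 2 + R + 2 * t * (p * q)) : 1 ≤ t := by
  by_contra! hlt
  have hpq := mul_pos hp hq
  have h1 : 0 < (1 - t) * ((t * (p ^ 2 + q ^ 2) - p * q) + ((p ^ 2 + q ^ 2) - p * q)) :=
    mul_pos (by linarith) (by nlinarith)
  have h2 : 2 * (p * q) + R < p ^ 2 := by linarith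
  have h3 : 2 * q ≤ p := by
    refine le_of_mul_le_mul_left ?_ hp
    linarith
  have h4 : (p ^ 2 + q ^ 2 + R) * q ^ 2 ≤ 2 * p ^ 2 * q ^ 2 := by
    refine mul_le_mul_of_nonneg_right ?_ (sq_nonneg q)
    nlinarith
  have h5 : (2 * q) ^ 2 ≤ p ^ 2 := by gcongr
  have h6 := mul_le_mul_of_nonneg_left h5 (sq_nonneg p)
  have h7 := pow_pos hp 4
  linarith

/-- The square root of `n * pairRatio` is the larger root of the pair equation. -/
theorem exists_natCast_mul_pairRatio {n : ℕ} (hn : 2 ≤ n) {L : Fin n → ℝ} (hL : ∀ i, 0 < L i)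
    {a b : Fin n} (ha : a = ⟨0, by omega⟩) (hb : b = ⟨1, by omega⟩)
    (hcase : √(L a) ^ 4 < (∑ i, √(L i) ^ 2) * √(L b) ^ 2) (hba : √(L b) ≤ √(L a)) :
    ∃ t : ℝ, 1 ≤ t ∧ n * pairRatio hn L = t ^ 2 ∧
      t ^ 2 * (√(L a) ^ 2 + √(L b) ^ 2) + √(L a) ^ 2 =
        ∑ i, √(L i) ^ 2 + 2 * t * (√(L a) * √(L b)) := by
  have hn' : (n : ℝ) ≠ 0 := by
    have : n ≠ 0 := by omega
    exact_mod_cast this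
  have hxa : 0 < √(L a) := Real.sqrt_pos.2 (hL a)
  have hxb : 0 < √(L b) := Real.sqrt_pos.2 (hL b)
  have hsqa : L a = √(L a) ^ 2 := (Real.sq_sqrt (hL a).le).symm
  have hsqb : L b = √(L b) ^ 2 := (Real.sq_sqrt (hL b).le).symm
  set R := ∑ i : Fin n with 2 ≤ i.val, L i with hR
  have hR0 : 0 ≤ R := Finset.sum_nonneg fun i _ => (hL i).le
  have hT : ∑ i, √(L i) ^ 2 = L a + L b + R := by
    simp only [Real.sq_sqrt (hL _).le]
    rw [← sum_filter_lt_add_sum_filter_le L 2]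
    congr 1
    have : (univ.filter fun i : Fin n => i.val < 2) = {a, b} := by
      ext i
      simp [ha, hb, Fin.ext_iff]
      omega
    rw [this, Finset.sum_pair (by simp [ha, hb])]
  have hprod : √(L a * L b) = √(L a) * √(L b) := Real.sqrt_mul (hL a).le _
  have hdef : pairRatio hn L = (√(L b ^ 2 + 2 * L a * L b + (L a + L b) * R) + √(L a * L b)) ^ 2 /
      (n * (L a + L b) ^ 2) := by
    rw [pairRatio, ha, hb]
  have hpos : 0 < L a + L b := add_pos (hL a) (hL b)
  have hD0 : 0 ≤ L b ^ 2 + 2 * L a * L b + (L a + L b) * R := by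
    have := hL a
    have := hL b
    positivity
  set D := √(L b ^ 2 + 2 * L a * L b + (L a + L b) * R) with hD
  have hDsq : D ^ 2 = L b ^ 2 + 2 * L a * L b + (L a + L b) * R := Real.sq_sqrt hD0
  have hDnn : 0 ≤ D := Real.sqrt_nonneg _
  rw [hprod] at hdef
  rw [hT] at hcase ⊢
  generalize √(L a) = p at *
  generalize √(L b) = q at *
  rw [hsqa, hsqb] at hcase hdef hpos hDsq ⊢
  have hpq := mul_pos hxa hxb
  set t := (D + p * q) / (p ^ 2 + q ^ 2) with ht
  have htP : t * (p ^ 2 + q ^ 2) = D + p * q := div_mul_cancel₀ _ hpos.ne'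
  have hquad : t ^ 2 * (p ^ 2 + q ^ 2) + p ^ 2 = p ^ 2 + q ^ 2 + R + 2 * t * (p * q) := by
    refine mul_right_cancel₀ hpos.ne' ?_
    have : (t * (p ^ 2 + q ^ 2) - p * q) ^ 2 = D ^ 2 := by rw [htP]; ring
    nlinarith
  refine ⟨t, ?_, ?_, hquad⟩
  · exact one_le_of_pair_equation hxa hxb hR0 hba hcase (by linarith) hquad
  · rw [hdef, ht]
    field_simp

/-! ### The two cases of the theorem -/

theorem theorem2 (n : ℕ) (hn : 2 ≤ n) (L : Fin n → ℝ) (hpos : ∀ i, 0 < L i)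
    (hanti : Antitone L) :
    (∀ U : Set (Fin n → ℝ), IsUtilitySet L U → ∃! p : ℝ, IsPriceOfPropFairness U p) ∧
    ((∑ i, L i) * L ⟨1, by omega⟩ ≤ L ⟨0, by omega⟩ ^ 2 →
      (∀ U : Set (Fin n → ℝ), IsUtilitySet L U → ∀ p : ℝ, IsPriceOfPropFairness U p →
        p ≤ 1 - minPrefixRatio hn L) ∧
      ∃ U : Set (Fin n → ℝ), IsUtilitySet L U ∧
        IsPriceOfPropFairness U (1 - minPrefixRatio hn L)) ∧
    (L ⟨0, by omega⟩ ^ 2 < (∑ i, L i) * L ⟨1, by omega⟩ →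
      (∀ U : Set (Fin n → ℝ), IsUtilitySet L U → ∀ p : ℝ, IsPriceOfPropFairness U p →
        p ≤ 1 - min (minPrefixRatio hn L) (pairRatio hn L)) ∧
      ∃ U : Set (Fin n → ℝ), IsUtilitySet L U ∧
        IsPriceOfPropFairness U (1 - min (minPrefixRatio hn L) (pairRatio hn L))) := by
  have hn0 : 0 < n := by omega
  have hnpos : (0 : ℝ) < n := by exact_mod_cast hn0
  obtain ⟨a, ha⟩ : ∃ a : Fin n, a = ⟨0, by omega⟩ := ⟨_, rfl⟩
  obtain ⟨b, hb⟩ : ∃ b : Fin n, b = ⟨1, by omega⟩ := ⟨_, rfl⟩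
  rw [← ha, ← hb]
  have hx : ∀ i, 0 < √(L i) := fun i => Real.sqrt_pos.2 (hpos i)
  have hxL : ∀ i, √(L i) ^ 2 = L i := fun i => Real.sq_sqrt (hpos i).le
  have hxa : ∀ i, √(L i) ≤ √(L a) := fun i =>
    Real.sqrt_le_sqrt (hanti (by rw [ha]; exact Nat.zero_le _))
  have hxb : ∀ i, i ≠ a → √(L i) ≤ √(L b) := fun i hi => by
    refine Real.sqrt_le_sqrt (hanti ?_)
    rw [hb, Fin.le_def]
    have : i.val ≠ 0 := fun h => hi (by rw [ha]; exact Fin.ext h)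
    simp only
    omega
  have hab : a ≠ b := by simp [ha, hb]
  have hm1 : 1 ≤ n * minPrefixRatio hn L := by
    obtain ⟨l, hl, hml⟩ := exists_minPrefixRatio_eq hn L
    rw [hml]
    exact one_le_natCast_mul_prefixRatio hpos hn0 hl
  have key : ∀ ρ : ℝ, KnapsackBound L (n * ρ) → ∀ U : Set (Fin n → ℝ), IsUtilitySet L U →
      ∀ p : ℝ, IsPriceOfPropFairness U p → p ≤ 1 - ρ := by
    intro ρ hK U hU p hp
    have := hU.price_le hn0 hpos hK hp
    rwa [mul_div_cancel_left₀ _ hnpos.ne'] at this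
  have hest : ∀ r : ℝ, r ^ 2 ≤ n * minPrefixRatio hn L → ∀ S : Finset (Fin n),
      0 ≤ (∑ i ∈ S, √(L i)) ^ 2 + ∑ i, √(L i) ^ 2 - (1 + r ^ 2) * ∑ i ∈ S, √(L i) ^ 2 :=
    fun r h => subset_estimate hpos hanti hn0 (sq_nonneg r) (le_natCast_mul_prefixRatio h)
  have hTa : ∀ r : ℝ, r ^ 2 ≤ n * minPrefixRatio hn L →
      r ^ 2 * √(L a) ^ 2 ≤ ∑ i, √(L i) ^ 2 := fun r h => by
    have := hest r h {a}
    simp only [Finset.sum_singleton] at this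
    linarith
  refine ⟨fun U hU => hU.existsUnique_price hn0 hpos, fun hcase => ?_, fun hcase => ?_⟩
  · have hK : KnapsackBound L (n * minPrefixRatio hn L) := by
      have hr := Real.one_le_sqrt.2 hm1
      have hr2 := Real.sq_sqrt (zero_le_one.trans hm1)
      rw [← hr2]
      refine knapsackBound_of_subset_of_pair hx hxL hr (hest _ hr2.le) hxa hxb (Or.inl ?_)
      have hT := hTa _ hr2.le
      generalize √(n * minPrefixRatio hn L) = r at *
      simp only [hxL] at hT
      -- The prefix `l = 1` gives `r² L₁ ≤ ∑ L`; multiplying by `L₂` and using the case hypothesis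
      -- gives `r² L₂ ≤ L₁`.
      have h1 : (r * √(L b)) ^ 2 ≤ √(L a) ^ 2 := by
        rw [mul_pow, hxL, hxL]
        refine le_of_mul_le_mul_left ?_ (hpos a)
        have := mul_le_mul_of_nonneg_right hT (hpos b).le
        nlinarith
      exact (pow_le_pow_iff_left₀ (by have := hx b; positivity) (hx a).le two_ne_zero).1 h1
    exact ⟨key _ hK, exists_price_eq_minPrefixRatio hn hpos hanti hK⟩
  · have hcase' : √(L a) ^ 4 < (∑ i, √(L i) ^ 2) * √(L b) ^ 2 := by
      simp only [hxL]
      calc √(L a) ^ 4 = (√(L a) ^ 2) ^ 2 := by ring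
        _ = L a ^ 2 := by rw [hxL]
        _ < _ := hcase
    obtain ⟨t, ht1, htn, hteq⟩ := exists_natCast_mul_pairRatio hn hpos ha hb hcase' (hxa b)
    have hKr : ∀ r : ℝ, 1 ≤ r → r ^ 2 ≤ n * minPrefixRatio hn L → r ≤ t →
        KnapsackBound L (r ^ 2) := by
      intro r hr hrm hrt
      refine knapsackBound_of_subset_of_pair hx hxL hr (hest r hrm) hxa hxb (Or.inr ?_)
      -- The pair quadratic is increasing on `[1, t]`, so equality at `t` gives the inequality at
      -- `r`.
      have : 0 ≤ (t - r) * ((t + r) * (√(L a) ^ 2 + √(L b) ^ 2) - 2 * (√(L a) * √(L b))) := by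
        apply mul_nonneg (by linarith)
        nlinarith [sq_nonneg (√(L a) - √(L b)), sq_nonneg √(L a), sq_nonneg √(L b)]
      nlinarith
    rcases le_total (minPrefixRatio hn L) (pairRatio hn L) with h | h
    · rw [min_eq_left h]
      have hK : KnapsackBound L (n * minPrefixRatio hn L) := by
        have hr2 := Real.sq_sqrt (zero_le_one.trans hm1)
        rw [← hr2]
        refine hKr _ (Real.one_le_sqrt.2 hm1) hr2.le (Real.sqrt_le_iff.2 ⟨by linarith, ?_⟩)
        rw [← htn]
        gcongr
      exact ⟨key _ hK, exists_price_eq_minPrefixRatio hn hpos hanti hK⟩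
    · rw [min_eq_right h]
      have htm : t ^ 2 ≤ n * minPrefixRatio hn L := by rw [← htn]; gcongr
      have hK := hKr t ht1 htm le_rfl
      refine ⟨key _ (htn ▸ hK), ?_⟩
      have hT := hTa t htm
      -- Needed for a nonnegative share of `b`. If it fails, the pair equation, read as `T = t²p² +
      -- (p - tq)²`, contradicts the case hypothesis.
      have hta : √(L a) ≤ t * √(L b) := by
        by_contra! hlt
        have hp := hx a
        have hq := hx b
        have hqp := hxa b
        generalize √(L a) = p at *
        generalize √(L b) = q at *
        have e : ∑ i, √(L i) ^ 2 = t ^ 2 * p ^ 2 + (p - t * q) ^ 2 := by linarith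
        rw [e] at hcase'
        have h1 : (t * q) ^ 2 * (p - t * q) ^ 2 ≤ t ^ 2 * p ^ 2 * ((p - t * q) * (p + t * q)) := by
          have h2 : 0 ≤ p - t * q := by linarith
          have h3 : 0 ≤ t * q := by positivity
          have h4 : (t * q) ^ 2 ≤ (t * p) ^ 2 := by gcongr
          rw [← mul_pow t p]
          have h5 : (p - t * q) ^ 2 ≤ (p - t * q) * (p + t * q) := by nlinarith
          exact mul_le_mul h4 h5 (sq_nonneg _) (sq_nonneg _)
        nlinarith [mul_lt_mul_of_pos_left hcase' (pow_pos (by linarith : 0 < t) 2)]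
      have htn2 : t ^ 2 ≤ n := by
        refine le_of_mul_le_mul_right (hT.trans ?_) (pow_pos (hx a) 2)
        calc ∑ i, √(L i) ^ 2 ≤ ∑ _i : Fin n, √(L a) ^ 2 :=
              Finset.sum_le_sum fun i _ => pow_le_pow_left₀ (hx i).le (hxa i) 2
          _ = n * √(L a) ^ 2 := by simp
      have := exists_price_eq_of_pair hx hxL ht1 hK hab (hxa b) hta htn2 hteq
      rwa [← htn, mul_div_cancel_left₀ _ hnpos.ne'] at this
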